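/- Let $n,m$ be non-negative integers and let $A_1,\ldots,A_m\in\mathbb{R}^{n\times n}$ be (symmetric) positive semidefinite matrices with $\sum_{i=1}^m A_i\preceq I_n$. Let $\alpha,\beta,\varepsilon\in(0,1)$ satisfy $m=\frac{n}{\varepsilon^2}$ and $\frac15\ge\alpha^2\ge 5\beta$, and let $J\subseteq\{1,\ldots,m\}$ with $|J|\le\beta m$. Define $$K:=\Big\{x\in\mathbb{R}^m : \Big\|\sum_{i=1}^m x_iA_i\Big\|_{\mathrm{op}}\le\varepsilon\Big\},\qquad K(J):=K\cap\{x\in\mathbb{R}^m : x_j=0\ \text{for all } j\in J\},$$ where $\|\cdot\|_{\mathrm{op}}$ is the operator norm with respect to the Euclidean norm. Then $$\gamma_m\Big(\frac{50}{\alpha}K(J)+\alpha\sqrt m\,B_2^m\Big)\ge\frac12,$$ where $\gamma_m$ is the standard Gaussian measure $N(0,I_m)$ on $\mathbb{R}^m$, $B_2^m$ is the closed Euclidean unit ball of $\mathbb{R}^m$, and $+$ denotes the Minkowski sum. -/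

import Mathlib

open scoped Pointwise MatrixOrder

/-- The body of all `x ∈ ℝ^m` such that `∑ i, x i • A i` has operator norm (with respect to the
Euclidean norm on `ℝ^n`) at most `ε`. -/
def spectralBody {n m : ℕ} (A : Fin m → Matrix (Fin n) (Fin n) ℝ) (ε : ℝ) :
    Set (EuclideanSpace ℝ (Fin m)) :=
  {x | ‖Matrix.toEuclideanCLM (n := Fin n) (𝕜 := ℝ) (∑ i, x i • A i)‖ ≤ ε}

/-- The section `K(J) = K ∩ {x : x j = 0 for all j ∈ J}`. -/
def coordinateSection {m : ℕ} (K : Set (EuclideanSpace ℝ (Fin m))) (J : Finset (Fin m)) :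
    Set (EuclideanSpace ℝ (Fin m)) :=
  K ∩ {x | ∀ j ∈ J, x j = 0}

/-! Put `t = 50ε/α`. On `‖X‖ < t`, where `X = ∑ xᵢAᵢ`, consider the convex barrier `ψ = (4/t)(tr (t
- X)⁻¹ + tr (t + X)⁻¹)`. Its proximal map sends a Gaussian `g` to the `x` with `x + ∇ψ(x) = g`, a
point of the domain; it remains to bound `E‖g - x‖²`. The displacement `u = g - x` equals `∇ψ(x)`.
Integration by parts gives `E⟨g, u⟩ = E div u`, and `⟨g, u⟩ = ⟨x, u⟩ + ‖u‖²`, so `E‖u‖² = E(div u -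
⟨x, ∇ψ(x)⟩)`. With `H` the Hessian of `ψ`, `div u = tr (1 - (1 + H)⁻¹) ≤ ∑ min(1, Hᵢᵢ)`.
`sum_le_inner_barrierGrad` shows pointwise that this exceeds the radial derivative `⟨x, ∇ψ(x)⟩` by
at most `16n/t²`, and `integral_norm_sub_sq_le` carries out the averaging. For `K(J)`, replace `Aⱼ`
by `0` for `j ∈ J` and then delete those coordinates of `x`; the extra cost has mean `|J| ≤ βm`.
Altogether the mean squared distance is at most `α²m/2`, and Markov's inequality concludes. -/

/-! ### Gaussian integration by parts. -/

open MeasureTheory ProbabilityTheory in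
/-- Gaussian integration by parts on the line. -/
theorem integral_mul_gaussianReal_eq_integral_deriv {f f' : ℝ → ℝ} {C : ℝ}
    (hf : ∀ x, HasDerivAt f (f' x) x) (hC : ∀ x, |f' x| ≤ C)
    (hint : Integrable (fun x => x * f x) (gaussianReal 0 1)) (hf1 : Integrable f (gaussianReal 0 1)) :
    ∫ x, x * f x ∂(gaussianReal 0 1) = ∫ x, f' x ∂(gaussianReal 0 1) := by
  have hv : (1 : NNReal) ≠ 0 := one_ne_zero
  have hder : f' = deriv f := by ext x; exact (hf x).deriv.symm
  have hf'm : Measurable f' := hder ▸ measurable_deriv f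
  have hf' : Integrable f' (gaussianReal 0 1) :=
    Integrable.of_bound hf'm.aestronglyMeasurable C (Filter.Eventually.of_forall hC)
  have key : ∀ h : ℝ → ℝ, Integrable h (gaussianReal 0 1) →
      Integrable (fun x => h x * gaussianPDFReal 0 1 x) := by
    intro h hh
    rw [gaussianReal_of_var_ne_zero _ hv, integrable_withDensity_iff_integrable_smul'
      (measurable_gaussianPDF _ _) (by simp [gaussianPDF])] at hh
    refine hh.congr (Filter.Eventually.of_forall fun x => ?_)
    simp [toReal_gaussianPDF, mul_comm]
  have hd : ∀ x, HasDerivAt (gaussianPDFReal 0 1) (-(x * gaussianPDFReal 0 1 x)) x := by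
    intro x
    have h1 : HasDerivAt (fun y : ℝ => -(y - 0) ^ 2 / (2 * ((1 : NNReal) : ℝ))) (-x) x := by
      have h2 : HasDerivAt (fun y : ℝ => y - 0) 1 x := (hasDerivAt_id x).sub_const 0
      have := ((h2.pow 2).neg).div_const (2 * ((1 : NNReal) : ℝ))
      exact this.congr_deriv (by norm_num; ring)
    have := (h1.exp).const_mul ((√(2 * Real.pi * ((1 : NNReal) : ℝ)))⁻¹)
    refine this.congr_deriv ?_
    simp only [gaussianPDFReal]
    ring
  have h := integral_mul_deriv_eq_deriv_mul_of_integrable (u := f) (u' := f')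
    (v := gaussianPDFReal 0 1) (v' := fun x => -(x * gaussianPDFReal 0 1 x))
    (fun x _ => hf x) (fun x _ => hd x)
    ((key _ hint).neg.congr (Filter.Eventually.of_forall fun x => by
      simp only [Pi.neg_apply, Pi.mul_apply]; ring)) (key _ hf') (key _ hf1)
  rw [integral_gaussianReal_eq_integral_smul hv, integral_gaussianReal_eq_integral_smul hv]
  simp only [smul_eq_mul]
  have e1 : ∫ x, gaussianPDFReal 0 1 x * (x * f x) =
      - ∫ x, f x * (-(x * gaussianPDFReal 0 1 x)) := by
    rw [← integral_neg]; congr 1; ext x; ring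
  rw [e1, h, neg_neg]
  congr 1; ext x; ring

open MeasureTheory ProbabilityTheory in
/-- Gaussian integration by parts in `ℝ^m` along a coordinate direction. -/
theorem integral_coord_mul_stdGaussian {m : ℕ} (i : Fin m) {f : EuclideanSpace ℝ (Fin m) → ℝ}
    (hf : Differentiable ℝ f) {C : ℝ}
    (hC : ∀ x, |fderiv ℝ f x (EuclideanSpace.single i 1)| ≤ C)
    (hint : Integrable (fun x => x i * f x) (stdGaussian (EuclideanSpace ℝ (Fin m))))
    (hf1 : Integrable f (stdGaussian (EuclideanSpace ℝ (Fin m)))) :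
    ∫ x, x i * f x ∂(stdGaussian (EuclideanSpace ℝ (Fin m))) =
      ∫ x, fderiv ℝ f x (EuclideanSpace.single i 1) ∂(stdGaussian (EuclideanSpace ℝ (Fin m))) := by
  obtain _ | k := m
  · exact i.elim0
  have hf2 : Integrable (fun x => fderiv ℝ f x (EuclideanSpace.single i 1))
      (stdGaussian (EuclideanSpace ℝ (Fin (k + 1)))) :=
    Integrable.of_bound (measurable_fderiv_apply_const ℝ f _).aestronglyMeasurable C
      (Filter.Eventually.of_forall hC)
  let γ := gaussianReal 0 1
  let π : Measure (Fin k → ℝ) := Measure.pi fun _ => γ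
  let e := (MeasurableEquiv.piFinSuccAbove (fun _ : Fin (k + 1) => ℝ) i).symm
  -- Fubini with coordinate `i` split off: for fixed remaining coordinates the claim is the
  -- one-dimensional one.
  let φ : ℝ × (Fin k → ℝ) → EuclideanSpace ℝ (Fin (k + 1)) := fun p => WithLp.toLp 2 (e p)
  have hφ : MeasurePreserving φ (γ.prod π) (stdGaussian (EuclideanSpace ℝ (Fin (k + 1)))) := by
    have h1 : MeasurePreserving e (γ.prod π) (Measure.pi fun _ => γ) :=
      (measurePreserving_piFinSuccAbove (fun _ : Fin (k + 1) => γ) i).symm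
    have h2 : MeasurePreserving (WithLp.toLp 2) (Measure.pi fun _ : Fin (k + 1) => γ)
        (stdGaussian (EuclideanSpace ℝ (Fin (k + 1)))) :=
      ⟨by fun_prop, map_pi_eq_stdGaussian⟩
    exact h2.comp h1
  have hswap : ∀ h : EuclideanSpace ℝ (Fin (k + 1)) → ℝ,
      Integrable h (stdGaussian (EuclideanSpace ℝ (Fin (k + 1)))) →
      ∫ x, h x ∂(stdGaussian (EuclideanSpace ℝ (Fin (k + 1)))) =
        ∫ y, ∫ s, h (φ (s, y)) ∂γ ∂π ∧ ∀ᵐ y ∂π, Integrable (fun s => h (φ (s, y))) γ := by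
    intro h hh
    have hc : Integrable (fun p => h (φ p)) (γ.prod π) := hφ.integrable_comp_of_integrable hh
    refine ⟨?_, hc.prod_left_ae⟩
    rw [← integral_prod_symm _ hc, ← hφ.map_eq, integral_map hφ.measurable.aemeasurable]
    rw [hφ.map_eq]
    exact hh.aestronglyMeasurable
  obtain ⟨a1, a2⟩ := hswap _ hint
  obtain ⟨b1, -⟩ := hswap _ hf2
  obtain ⟨-, c2⟩ := hswap _ hf1
  rw [a1, b1]
  refine integral_congr_ae ?_
  filter_upwards [a2, c2] with y ha hc
  have hφe : ∀ s, φ (s, y) = WithLp.toLp 2 (i.insertNth s y) := fun s => rfl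
  have hi : ∀ s, (φ (s, y)) i = s := fun s => by simp [hφe]
  have hd : ∀ s, HasDerivAt (fun s => φ (s, y)) (EuclideanSpace.single i 1) s := by
    intro s
    have : (fun s => φ (s, y)) = fun s => φ (0, y) + s • EuclideanSpace.single i (1 : ℝ) := by
      ext s j
      rcases eq_or_ne j i with rfl | hj
      · simp [hφe]
      · obtain ⟨j', rfl⟩ := Fin.exists_succAbove_eq hj
        simp [hφe]
    rw [this]
    simpa using ((hasDerivAt_id s).smul_const (EuclideanSpace.single i (1 : ℝ))).const_add (φ (0, y))
  simp only [hi] at ha ⊢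
  exact integral_mul_gaussianReal_eq_integral_deriv (C := C)
    (fun s => (hf _).hasFDerivAt.comp_hasDerivAt s (hd s)) (fun s => hC _) ha hc

/-! ### Trace and order inequalities for real matrices. -/

namespace Matrix

open scoped Matrix.Norms.L2Operator

variable {k : Type*} [Fintype k] [DecidableEq k]

theorem PosSemidef.exists_eq_conjTranspose_mul_self {M : Matrix k k ℝ} (hM : M.PosSemidef) :
    ∃ C : Matrix k k ℝ, M = Cᴴ * C := by
  refine ⟨CFC.sqrt M, ?_⟩
  have h := (nonneg_iff_posSemidef.1 (CFC.sqrt_nonneg M)).1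
  rw [h.eq, CFC.sqrt_mul_sqrt_self M (nonneg_iff_posSemidef.2 hM)]

theorem PosSemidef.trace_mul_nonneg {B N : Matrix k k ℝ} (hB : B.PosSemidef) (hN : N.PosSemidef) :
    0 ≤ (B * N).trace := by
  obtain ⟨C, rfl⟩ := hN.exists_eq_conjTranspose_mul_self
  rw [← mul_assoc, trace_mul_comm, ← mul_assoc]
  exact (hB.mul_mul_conjTranspose_same C).trace_nonneg

/-- For `M = CᴴC` the trace is the squared Frobenius norm of `C`, and Cauchy–Schwarz on each row of
`C` gives `‖Cv‖² ≤ (tr M)‖v‖²`. -/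
theorem PosSemidef.trace_smul_one_sub {M : Matrix k k ℝ} (hM : M.PosSemidef) :
    (M.trace • (1 : Matrix k k ℝ) - M).PosSemidef := by
  have hH : (M.trace • (1 : Matrix k k ℝ) - M).IsHermitian := by
    have := hM.1
    simp only [IsHermitian, conjTranspose_sub, conjTranspose_smul, conjTranspose_one, this.eq,
      star_trivial]
  refine PosSemidef.of_dotProduct_mulVec_nonneg hH fun v => ?_
  obtain ⟨C, rfl⟩ := hM.exists_eq_conjTranspose_mul_self
  have h1 : star v ⬝ᵥ ((Cᴴ * C) *ᵥ v) = ∑ i, (∑ j, C i j * v j) ^ 2 := by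
    rw [← mulVec_mulVec, dotProduct_mulVec]
    simp [dotProduct, mulVec, vecMul, sq, mul_comm]
  have h2 : (Cᴴ * C).trace = ∑ i, ∑ j, C i j ^ 2 := by
    rw [trace_mul_comm]
    simp [trace, mul_apply, sq]
  simp only [sub_mulVec, smul_mulVec, one_mulVec, dotProduct_sub, dotProduct_smul, smul_eq_mul]
  rw [h1, h2, sub_nonneg, Finset.sum_mul]
  refine Finset.sum_le_sum fun i _ => ?_
  have h3 : star v ⬝ᵥ v = ∑ j, v j ^ 2 := by simp [dotProduct, sq]
  rw [h3]
  exact Finset.sum_mul_sq_le_sq_mul_sq _ _ _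

theorem PosSemidef.trace_mul_le {B N : Matrix k k ℝ} (hB : B.PosSemidef) (hN : N.PosSemidef) :
    (B * N).trace ≤ B.trace * N.trace := by
  have := hB.trace_smul_one_sub.trace_mul_nonneg hN
  simpa [sub_mul, trace_sub, trace_smul] using this

/-- A positive definite matrix is bounded below in terms of the trace of its inverse. -/
theorem PosDef.sub_smul_one_posSemidef {P : Matrix k k ℝ} (hP : P.PosDef) {b : ℝ} (hb : 0 < b)
    (htr : P⁻¹.trace ≤ b) : (P - b⁻¹ • (1 : Matrix k k ℝ)).PosSemidef := by
  have hdet : IsUnit P.det := (isUnit_iff_isUnit_det P).1 hP.isUnit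
  have hM := hP.inv
  have h1 : (b • (1 : Matrix k k ℝ) - P⁻¹).PosSemidef := by
    have := hM.posSemidef.trace_smul_one_sub.add
      ((PosSemidef.one (n := k) (R := ℝ)).smul (sub_nonneg.2 htr))
    convert this using 1
    module
  -- Rests on the identity `P - b⁻¹ = (1 - b⁻¹P⁻¹) P (1 - b⁻¹P⁻¹) + b⁻²(b - P⁻¹)`, both summands
  -- being positive semidefinite.
  have h2 := hP.posSemidef.conjTranspose_mul_mul_same (1 - b⁻¹ • P⁻¹)
  have h3 : (1 - b⁻¹ • P⁻¹)ᴴ = 1 - b⁻¹ • P⁻¹ := by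
    rw [conjTranspose_sub, conjTranspose_smul, hM.1.eq, conjTranspose_one, star_trivial]
  rw [h3] at h2
  have h4 := h2.add (h1.smul (sq_nonneg b⁻¹))
  convert h4 using 1
  simp only [sub_mul, mul_sub, one_mul, mul_one, smul_mul_assoc, mul_smul_comm,
    nonsing_inv_mul _ hdet, mul_nonsing_inv _ hdet]
  have : b⁻¹ ^ 2 * b = b⁻¹ := by field_simp
  rw [smul_sub (b⁻¹ ^ 2), smul_smul, this]
  simp only [sq]
  module

theorem inner_toEuclideanCLM_self (X : Matrix k k ℝ) (v : EuclideanSpace ℝ k) :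
    inner ℝ (toEuclideanCLM (n := k) (𝕜 := ℝ) X v) v = star v.ofLp ⬝ᵥ (X *ᵥ v.ofLp) := by
  rw [EuclideanSpace.inner_eq_star_dotProduct, ofLp_toEuclideanCLM]
  simp

/-- The norm of a symmetric operator is the supremum of its absolute Rayleigh quotients. The `0` in
the maximum matters only for an empty index type, where `s` may be negative. -/
theorem norm_le_max_of_posSemidef {X : Matrix k k ℝ} {s : ℝ}
    (h1 : (s • (1 : Matrix k k ℝ) - X).PosSemidef) (h2 : (s • (1 : Matrix k k ℝ) + X).PosSemidef) :
    ‖X‖ ≤ max s 0 := by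
  have hX : X.IsHermitian := by
    have h := h1.1.eq
    rw [conjTranspose_sub, conjTranspose_smul, conjTranspose_one, star_trivial] at h
    exact sub_right_injective h
  rw [← l2_opNorm_toEuclideanCLM]
  have hs : ((toEuclideanCLM (n := k) (𝕜 := ℝ) X : EuclideanSpace ℝ k →L[ℝ] EuclideanSpace ℝ k) :
      EuclideanSpace ℝ k →ₗ[ℝ] EuclideanSpace ℝ k).IsSymmetric := by
    rw [coe_toEuclideanCLM_eq_toEuclideanLin]
    exact isSymmetric_toEuclideanLin_iff.2 hX
  rw [ContinuousLinearMap.norm_eq_iSup_rayleighQuotient _ hs]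
  refine Real.iSup_le (fun v => ?_) (le_max_right _ _)
  rcases eq_or_ne v 0 with rfl | hv
  · simp
  have h5 : 0 < ‖v‖ ^ 2 := pow_pos (norm_pos_iff.2 hv) 2
  have h4 : star v.ofLp ⬝ᵥ v.ofLp = ‖v‖ ^ 2 := by
    rw [EuclideanSpace.real_norm_sq_eq]; simp [dotProduct, sq]
  have e1 := h1.dotProduct_mulVec_nonneg v.ofLp
  have e2 := h2.dotProduct_mulVec_nonneg v.ofLp
  simp only [sub_mulVec, add_mulVec, smul_mulVec, one_mulVec, dotProduct_sub, dotProduct_add,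
    dotProduct_smul, smul_eq_mul, h4, ← inner_toEuclideanCLM_self] at e1 e2
  refine le_trans ?_ (le_max_left s 0)
  rw [ContinuousLinearMap.rayleighQuotient, ContinuousLinearMap.reApplyInnerSelf_apply, abs_div,
    abs_of_pos h5, div_le_iff₀ h5, abs_le]
  simp only [RCLike.re_to_real]
  constructor <;> linarith

theorem smul_one_sub_posDef {X : Matrix k k ℝ} (hX : X.IsHermitian) {t : ℝ} (h : ‖X‖ < t) :
    (t • (1 : Matrix k k ℝ) - X).PosDef := by
  refine PosDef.of_dotProduct_mulVec_pos ?_ fun v hv => ?_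
  · simp only [IsHermitian, conjTranspose_sub, conjTranspose_smul, conjTranspose_one, hX.eq,
      star_trivial]
  have h1 := inner_toEuclideanCLM_self X (WithLp.toLp 2 v)
  have h2 := real_inner_le_norm (toEuclideanCLM (n := k) (𝕜 := ℝ) X (WithLp.toLp 2 v)) (WithLp.toLp 2 v)
  have h3 := (toEuclideanCLM (n := k) (𝕜 := ℝ) X).le_opNorm (WithLp.toLp 2 v)
  rw [l2_opNorm_toEuclideanCLM] at h3
  have h4 : star v ⬝ᵥ v = ‖WithLp.toLp 2 v‖ ^ 2 := by
    rw [EuclideanSpace.real_norm_sq_eq]; simp [dotProduct, sq]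
  have h5 : 0 < ‖WithLp.toLp 2 v‖ := norm_pos_iff.2 (by simpa using hv)
  simp only [sub_mulVec, smul_mulVec, one_mulVec, dotProduct_sub, dotProduct_smul, smul_eq_mul]
  rw [h4, ← h1]
  nlinarith [mul_pos h5 (mul_pos h5 (sub_pos.2 h))]

/-- Monotonicity of `P ↦ -P⁻²` under the trace pairing. -/
theorem PosDef.trace_inv_sq_monotone {P Q : Matrix k k ℝ} (hP : P.PosDef) (hQ : Q.PosDef) :
    0 ≤ (P⁻¹ * (Q - P) * P⁻¹).trace - (Q⁻¹ * (Q - P) * Q⁻¹).trace := by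
  have dP : IsUnit P.det := (isUnit_iff_isUnit_det P).1 hP.isUnit
  have dQ : IsUnit Q.det := (isUnit_iff_isUnit_det Q).1 hQ.isUnit
  -- The tangent inequality for the convex function `P ↦ tr P⁻¹`, read off from `tr (P⁻¹ - Q⁻¹) Q
  -- (P⁻¹ - Q⁻¹) ≥ 0`. Adding it to its mirror image gives monotonicity.
  have key : ∀ {P Q : Matrix k k ℝ}, P.PosDef → Q.PosDef → IsUnit Q.det →
      0 ≤ (P⁻¹ * Q * P⁻¹).trace - 2 * P⁻¹.trace + Q⁻¹.trace := by
    intro P Q hP hQ dQ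
    have h := (hQ.posSemidef.conjTranspose_mul_mul_same (P⁻¹ - Q⁻¹)).trace_nonneg
    rw [conjTranspose_sub, hP.inv.1.eq, hQ.inv.1.eq] at h
    simp only [sub_mul, mul_sub, mul_assoc, mul_nonsing_inv _ dQ, nonsing_inv_mul_cancel_left _ _ dQ, mul_one,
      trace_sub] at h
    rw [← mul_assoc] at h
    linarith
  have h1 := key hP hQ dQ
  have h2 := key hQ hP dP
  simp only [mul_sub, sub_mul, nonsing_inv_mul _ dP, nonsing_inv_mul _ dQ, one_mul, trace_sub]
  linarith

/-- `tr (R A R A R) ≤ tr (R A) tr (R A R)`. -/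
theorem PosSemidef.trace_sandwich_le {R A : Matrix k k ℝ} (hR : R.PosSemidef) (hA : A.PosSemidef) :
    (R * A * R * A * R).trace ≤ (R * A).trace * (R * A * R).trace := by
  obtain ⟨C, rfl⟩ := hA.exists_eq_conjTranspose_mul_self
  -- After cycling, the left side is `tr (BN)` with `B = CRCᴴ` and `N = CR²Cᴴ`, so `tr (BN) ≤ tr B ·
  -- tr N` applies.
  have h1 := hR.mul_mul_conjTranspose_same C
  have h2 := (posSemidef_conjTranspose_mul_self (R * Cᴴ))
  have h := h1.trace_mul_le h2
  rw [conjTranspose_mul, conjTranspose_conjTranspose, hR.1.eq] at h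
  convert h using 1
  · rw [mul_assoc C R, mul_assoc C (R * Cᴴ), trace_mul_comm C]
    have e := trace_mul_comm (R * Cᴴ * C) (R * Cᴴ * C * R)
    simp only [mul_assoc] at e ⊢
    exact e
  · congr 1
    · rw [← mul_assoc, trace_mul_comm, mul_assoc]
    · rw [trace_mul_comm (C * R)]
      simp only [mul_assoc]

theorem PosSemidef.trace_mul_le_trace {R B : Matrix k k ℝ} (hR : R.PosSemidef) (hB : B ≤ 1) :
    (R * B).trace ≤ R.trace := by
  have := hR.trace_mul_nonneg (le_iff.1 hB)
  simpa [mul_sub, trace_sub] using this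

/-- Expands `tr (R - a)² ≥ 0`. It absorbs `tr R` into `tr R²` at a cost proportional to the
dimension, which is how `n` enters the final bound. -/
theorem IsHermitian.trace_mul_self_ge {R : Matrix k k ℝ} (hR : R.IsHermitian) (a : ℝ) :
    2 * a * R.trace ≤ (R * R).trace + a ^ 2 * Fintype.card k := by
  have h := (posSemidef_conjTranspose_mul_self (R - a • (1 : Matrix k k ℝ))).trace_nonneg
  simp only [conjTranspose_sub, conjTranspose_smul, conjTranspose_one, hR.eq, star_trivial,
    sub_mul, mul_sub, smul_mul_assoc, mul_smul_comm, one_mul, mul_one, trace_sub, trace_smul,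
    trace_one, smul_eq_mul] at h
  nlinarith

end Matrix

/-! ### Calculus of the trace of the resolvent of a matrix pencil. -/

section Resolvent

open Matrix
open scoped Matrix.Norms.L2Operator

variable {m n : ℕ}

/-- The linear matrix pencil `∑ i, x i • A i`. -/
noncomputable def pencil (A : Fin m → Matrix (Fin n) (Fin n) ℝ) :
    EuclideanSpace ℝ (Fin m) →L[ℝ] Matrix (Fin n) (Fin n) ℝ :=
  LinearMap.toContinuousLinearMap
    { toFun := fun x => ∑ i, x i • A i
      map_add' := fun x y => by simp [add_smul, Finset.sum_add_distrib]
      map_smul' := fun c x => by simp [Finset.smul_sum, smul_smul] }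

theorem pencil_apply (A : Fin m → Matrix (Fin n) (Fin n) ℝ) (x : EuclideanSpace ℝ (Fin m)) :
    pencil A x = ∑ i, x i • A i := rfl

theorem pencil_neg (A : Fin m → Matrix (Fin n) (Fin n) ℝ) (x : EuclideanSpace ℝ (Fin m)) :
    pencil (fun i => -A i) x = -pencil A x := by
  simp [pencil_apply]

theorem pencil_single (A : Fin m → Matrix (Fin n) (Fin n) ℝ) (i : Fin m) :
    pencil A (EuclideanSpace.single i 1) = A i := by
  simp [pencil_apply]

theorem pencil_isHermitian {A : Fin m → Matrix (Fin n) (Fin n) ℝ} (hA : ∀ i, (A i).IsHermitian)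
    (x : EuclideanSpace ℝ (Fin m)) : (pencil A x).IsHermitian := by
  rw [pencil_apply, IsHermitian, conjTranspose_sum]
  simp [(hA _).eq, -conjTranspose_eq_transpose_of_trivial]

/-- The resolvent `(t - ∑ i, x i • A i)⁻¹`. -/
noncomputable def pencilResolvent (t : ℝ) (A : Fin m → Matrix (Fin n) (Fin n) ℝ)
    (x : EuclideanSpace ℝ (Fin m)) : Matrix (Fin n) (Fin n) ℝ :=
  (t • (1 : Matrix (Fin n) (Fin n) ℝ) - pencil A x)⁻¹

/-- The gradient of `x ↦ tr (t - ∑ i, x i • A i)⁻¹`. -/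
noncomputable def resolventGrad (t : ℝ) (A : Fin m → Matrix (Fin n) (Fin n) ℝ)
    (x : EuclideanSpace ℝ (Fin m)) : EuclideanSpace ℝ (Fin m) :=
  WithLp.toLp 2 fun i => (pencilResolvent t A x * A i * pencilResolvent t A x).trace

/-- The Hessian of `x ↦ tr (t - ∑ i, x i • A i)⁻¹`. -/
noncomputable def resolventHess (t : ℝ) (A : Fin m → Matrix (Fin n) (Fin n) ℝ)
    (x : EuclideanSpace ℝ (Fin m)) : EuclideanSpace ℝ (Fin m) →L[ℝ] EuclideanSpace ℝ (Fin m) :=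
  LinearMap.toContinuousLinearMap
    { toFun := fun v => WithLp.toLp 2 fun i =>
        2 * (pencilResolvent t A x * pencil A v * pencilResolvent t A x * A i * pencilResolvent t A x).trace
      map_add' := fun v w => by
        ext i; simp [mul_add, add_mul, trace_add]
      map_smul' := fun c v => by
        ext i; simp [trace_smul]; ring }

theorem resolventHess_apply (t : ℝ) (A : Fin m → Matrix (Fin n) (Fin n) ℝ)
    (x v : EuclideanSpace ℝ (Fin m)) (i : Fin m) : resolventHess t A x v i =
      2 * (pencilResolvent t A x * pencil A v * pencilResolvent t A x * A i * pencilResolvent t A x).trace := rfl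

variable {A : Fin m → Matrix (Fin n) (Fin n) ℝ} {t : ℝ} {x y : EuclideanSpace ℝ (Fin m)}

theorem inner_trace_pencil (B C : Matrix (Fin n) (Fin n) ℝ) (v : EuclideanSpace ℝ (Fin m)) :
    inner ℝ v (WithLp.toLp 2 fun i => (B * A i * C).trace) = (B * pencil A v * C).trace := by
  simp [PiLp.inner_apply, pencil_apply, Finset.mul_sum, Finset.sum_mul, trace_sum, mul_comm]

theorem inner_resolventGrad (v : EuclideanSpace ℝ (Fin m)) :
    inner ℝ v (resolventGrad t A x) =
      (pencilResolvent t A x * pencil A v * pencilResolvent t A x).trace :=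
  inner_trace_pencil _ _ _

theorem inner_resolventHess (v w : EuclideanSpace ℝ (Fin m)) :
    inner ℝ w (resolventHess t A x v) =
      2 * (pencilResolvent t A x * pencil A v * pencilResolvent t A x * pencil A w *
        pencilResolvent t A x).trace := by
  rw [← inner_trace_pencil, ← inner_smul_right]
  rfl

theorem sub_pencil_posDef (hA : ∀ i, (A i).IsHermitian) (hx : ‖pencil A x‖ < t) :
    (t • (1 : Matrix (Fin n) (Fin n) ℝ) - pencil A x).PosDef :=
  smul_one_sub_posDef (pencil_isHermitian hA x) hx

theorem pencilResolvent_posDef (hA : ∀ i, (A i).IsHermitian) (hx : ‖pencil A x‖ < t) :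
    (pencilResolvent t A x).PosDef :=
  (sub_pencil_posDef hA hx).inv

theorem hasFDerivAt_pencilResolvent (hA : ∀ i, (A i).IsHermitian) (hx : ‖pencil A x‖ < t) :
    HasFDerivAt (pencilResolvent t A)
      ((ContinuousLinearMap.mulLeftRight ℝ _ (pencilResolvent t A x) (pencilResolvent t A x)).comp
        (pencil A)) x := by
  obtain ⟨P, hP⟩ := (sub_pencil_posDef hA hx).isUnit
  have h1 : HasFDerivAt (fun x => t • (1 : Matrix (Fin n) (Fin n) ℝ) - pencil A x)
      (-(pencil A)) x := (pencil A).hasFDerivAt.const_sub _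
  have h2 := hasFDerivAt_ringInverse (𝕜 := ℝ) P
  rw [hP] at h2
  have h3 := h2.comp x h1
  have h4 : ((P⁻¹ : (Matrix (Fin n) (Fin n) ℝ)ˣ) : Matrix (Fin n) (Fin n) ℝ) = pencilResolvent t A x := by
    rw [pencilResolvent, ← hP, coe_units_inv]
  have h5 : pencilResolvent t A = Ring.inverse ∘
      fun x => t • (1 : Matrix (Fin n) (Fin n) ℝ) - pencil A x := by
    ext1 y; simp [pencilResolvent, nonsing_inv_eq_ringInverse]
  rw [h5]
  refine h3.congr_fderiv ?_
  rw [h4, h5]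
  ext1 v
  simp

/-- The trace as a continuous linear map. -/
noncomputable def traceCLM (n : ℕ) : Matrix (Fin n) (Fin n) ℝ →L[ℝ] ℝ :=
  LinearMap.toContinuousLinearMap (traceLinearMap (Fin n) ℝ ℝ)

theorem traceCLM_apply (M : Matrix (Fin n) (Fin n) ℝ) : traceCLM n M = M.trace := rfl

theorem hasFDerivAt_trace_pencilResolvent (hA : ∀ i, (A i).IsHermitian) (hx : ‖pencil A x‖ < t) :
    HasFDerivAt (fun y => (pencilResolvent t A y).trace) (innerSL ℝ (resolventGrad t A x)) x := by
  refine ((traceCLM n).hasFDerivAt.comp x (hasFDerivAt_pencilResolvent hA hx)).congr_fderiv ?_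
  ext1 v
  simp only [innerSL_apply_apply]
  rw [real_inner_comm, inner_resolventGrad]
  simp [traceCLM_apply]

theorem inner_resolventGrad_sub_nonneg (hA : ∀ i, (A i).IsHermitian) (hx : ‖pencil A x‖ < t)
    (hy : ‖pencil A y‖ < t) :
    0 ≤ inner ℝ (x - y) (resolventGrad t A x - resolventGrad t A y) := by
  have h := (sub_pencil_posDef hA hx).trace_inv_sq_monotone (sub_pencil_posDef hA hy)
  rw [inner_sub_right, inner_resolventGrad, inner_resolventGrad]
  rw [show pencil A (x - y) = t • (1 : Matrix (Fin n) (Fin n) ℝ) - pencil A y -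
    (t • (1 : Matrix (Fin n) (Fin n) ℝ) - pencil A x) by rw [map_sub]; abel]
  exact h

theorem inner_resolventHess_self_nonneg (hA : ∀ i, (A i).IsHermitian) (hx : ‖pencil A x‖ < t)
    (v : EuclideanSpace ℝ (Fin m)) : 0 ≤ inner ℝ v (resolventHess t A x v) := by
  have hR := pencilResolvent_posDef hA hx
  have h := (hR.posSemidef.mul_mul_conjTranspose_same
    (pencilResolvent t A x * pencil A v)).trace_nonneg
  rw [inner_resolventHess]
  rw [conjTranspose_mul, hR.1.eq, (pencil_isHermitian hA v).eq] at h
  simp only [mul_assoc] at h ⊢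
  linarith

/-- A trace is invariant under transposition, which reverses the product. This makes the Hessian
symmetric and merges the two product-rule terms into a factor `2`. -/
theorem trace_sandwich_symm {R B C : Matrix (Fin n) (Fin n) ℝ} (hR : R.IsHermitian)
    (hB : B.IsHermitian) (hC : C.IsHermitian) :
    (R * B * R * C * R).trace = (R * C * R * B * R).trace := by
  have h := trace_conjTranspose (R * B * R * C * R)
  simp only [conjTranspose_mul, hR.eq, hB.eq, hC.eq, star_trivial] at h
  rw [← h]
  simp only [mul_assoc]

theorem inner_resolventHess_symm (hA : ∀ i, (A i).IsHermitian) (hx : ‖pencil A x‖ < t)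
    (v w : EuclideanSpace ℝ (Fin m)) :
    inner ℝ w (resolventHess t A x v) = inner ℝ v (resolventHess t A x w) := by
  rw [inner_resolventHess, inner_resolventHess, trace_sandwich_symm (pencilResolvent_posDef hA hx).1
    (pencil_isHermitian hA v) (pencil_isHermitian hA w)]

theorem hasFDerivAt_resolventGrad (hA : ∀ i, (A i).IsHermitian) (hx : ‖pencil A x‖ < t) :
    HasFDerivAt (resolventGrad t A) (resolventHess t A x) x := by
  rw [← hasFDerivWithinAt_univ, hasFDerivWithinAt_euclidean]
  intro i
  rw [hasFDerivWithinAt_univ]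
  have h := hasFDerivAt_pencilResolvent hA hx
  have h2 := (traceCLM n).hasFDerivAt.comp x ((h.mul_const' (A i)).mul' h)
  refine h2.congr_fderiv ?_
  ext1 v
  have e := trace_sandwich_symm (pencilResolvent_posDef hA hx).1 (pencil_isHermitian hA v) (hA i)
  simp [traceCLM_apply, resolventHess_apply]
  simp only [← mul_assoc, e]
  ring

end Resolvent

/-! ### The two-sided barrier and its proximal equation. -/

section Barrier

open Matrix
open scoped Matrix.Norms.L2Operator

variable {m n : ℕ}

/-- The barrier `c (tr (t - X)⁻¹ + tr (t + X)⁻¹)` with `X = ∑ i, x i • A i`. -/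
noncomputable def barrier (t c : ℝ) (A : Fin m → Matrix (Fin n) (Fin n) ℝ)
    (x : EuclideanSpace ℝ (Fin m)) : ℝ :=
  c * ((pencilResolvent t A x).trace + (pencilResolvent t (fun i => -A i) x).trace)

/-- The gradient of `barrier`. -/
noncomputable def barrierGrad (t c : ℝ) (A : Fin m → Matrix (Fin n) (Fin n) ℝ)
    (x : EuclideanSpace ℝ (Fin m)) : EuclideanSpace ℝ (Fin m) :=
  c • (resolventGrad t A x + resolventGrad t (fun i => -A i) x)

/-- The Hessian of `barrier`. -/
noncomputable def barrierHess (t c : ℝ) (A : Fin m → Matrix (Fin n) (Fin n) ℝ)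
    (x : EuclideanSpace ℝ (Fin m)) : EuclideanSpace ℝ (Fin m) →L[ℝ] EuclideanSpace ℝ (Fin m) :=
  c • (resolventHess t A x + resolventHess t (fun i => -A i) x)

variable {A : Fin m → Matrix (Fin n) (Fin n) ℝ} {t c : ℝ} {x y : EuclideanSpace ℝ (Fin m)}

/-- The second half of the barrier is the first half for the family `-Aᵢ`, with the same domain;
barrier facts thus come from applying resolvent facts twice. -/
theorem norm_pencil_neg : ‖pencil (fun i => -A i) x‖ = ‖pencil A x‖ := by
  rw [pencil_neg, norm_neg]

theorem isHermitian_neg_family (hA : ∀ i, (A i).IsHermitian) (i : Fin m) :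
    (-A i).IsHermitian := (hA i).neg

theorem hasFDerivAt_barrier (hA : ∀ i, (A i).IsHermitian) (hx : ‖pencil A x‖ < t) :
    HasFDerivAt (barrier t c A) (innerSL ℝ (barrierGrad t c A x)) x := by
  have h1 := hasFDerivAt_trace_pencilResolvent hA hx
  have h2 := hasFDerivAt_trace_pencilResolvent (isHermitian_neg_family hA) (norm_pencil_neg.trans_lt hx)
  refine ((h1.add h2).const_mul c).congr_fderiv ?_
  ext1 v
  simp [barrierGrad]

theorem hasFDerivAt_barrierGrad (hA : ∀ i, (A i).IsHermitian) (hx : ‖pencil A x‖ < t) :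
    HasFDerivAt (barrierGrad t c A) (barrierHess t c A x) x :=
  ((hasFDerivAt_resolventGrad hA hx).add (hasFDerivAt_resolventGrad (isHermitian_neg_family hA)
    (norm_pencil_neg.trans_lt hx))).const_smul c

theorem inner_barrierGrad_sub_nonneg (hA : ∀ i, (A i).IsHermitian) (hc : 0 ≤ c)
    (hx : ‖pencil A x‖ < t) (hy : ‖pencil A y‖ < t) :
    0 ≤ inner ℝ (x - y) (barrierGrad t c A x - barrierGrad t c A y) := by
  have h1 := inner_resolventGrad_sub_nonneg hA hx hy
  have h2 := inner_resolventGrad_sub_nonneg (isHermitian_neg_family hA)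
    (norm_pencil_neg.trans_lt hx) (norm_pencil_neg.trans_lt hy)
  rw [barrierGrad, barrierGrad, ← smul_sub, inner_smul_right, add_sub_add_comm, inner_add_right]
  exact mul_nonneg hc (add_nonneg h1 h2)

theorem inner_barrierHess_self_nonneg (hA : ∀ i, (A i).IsHermitian) (hc : 0 ≤ c)
    (hx : ‖pencil A x‖ < t) (v : EuclideanSpace ℝ (Fin m)) :
    0 ≤ inner ℝ v (barrierHess t c A x v) := by
  have h1 := inner_resolventHess_self_nonneg hA hx v
  have h2 := inner_resolventHess_self_nonneg (isHermitian_neg_family hA)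
    (norm_pencil_neg.trans_lt hx) v
  simp only [barrierHess, _root_.add_apply, _root_.smul_apply,
    inner_smul_right, inner_add_right]
  exact mul_nonneg hc (add_nonneg h1 h2)

theorem inner_barrierHess_symm (hA : ∀ i, (A i).IsHermitian)
    (hx : ‖pencil A x‖ < t) (v w : EuclideanSpace ℝ (Fin m)) :
    inner ℝ w (barrierHess t c A x v) = inner ℝ v (barrierHess t c A x w) := by
  have h1 := inner_resolventHess_symm hA hx v w
  have h2 := inner_resolventHess_symm (isHermitian_neg_family hA)
    (norm_pencil_neg.trans_lt hx) v w
  simp only [barrierHess, _root_.add_apply, _root_.smul_apply,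
    inner_smul_right, inner_add_right, h1, h2]

/-- Sublevel sets of the barrier stay away from the boundary of its domain. -/
theorem norm_pencil_le_of_barrier_le (hA : ∀ i, (A i).IsHermitian) (hc : 0 < c)
    (hx : ‖pencil A x‖ < t) {b : ℝ} (hb : 0 < b) (h : barrier t c A x ≤ c * b) :
    ‖pencil A x‖ ≤ max (t - b⁻¹) 0 := by
  have hR := pencilResolvent_posDef hA hx
  have hS := pencilResolvent_posDef (isHermitian_neg_family hA) (norm_pencil_neg.trans_lt hx)
  have h' := le_of_mul_le_mul_left h hc
  have h1 := (sub_pencil_posDef hA hx).sub_smul_one_posSemidef hb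
    (show (pencilResolvent t A x).trace ≤ b by linarith [hS.posSemidef.trace_nonneg])
  have h2 := (sub_pencil_posDef (isHermitian_neg_family hA)
    (norm_pencil_neg.trans_lt hx)).sub_smul_one_posSemidef hb
    (show (pencilResolvent t (fun i => -A i) x).trace ≤ b by
      linarith [hR.posSemidef.trace_nonneg])
  rw [pencil_neg] at h2
  refine norm_le_max_of_posSemidef ?_ ?_
  · convert h1 using 1; module
  · convert h2 using 1; module

theorem barrier_nonneg (hA : ∀ i, (A i).IsHermitian) (hc : 0 ≤ c) (hx : ‖pencil A x‖ < t) :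
    0 ≤ barrier t c A x :=
  mul_nonneg hc (add_nonneg (pencilResolvent_posDef hA hx).posSemidef.trace_nonneg
    (pencilResolvent_posDef (isHermitian_neg_family hA)
      (norm_pencil_neg.trans_lt hx)).posSemidef.trace_nonneg)

/-- The proximal equation of the barrier is solvable. -/
theorem exists_add_barrierGrad_eq (hA : ∀ i, (A i).IsHermitian) (ht : 0 < t) (hc : 0 < c)
    (g : EuclideanSpace ℝ (Fin m)) :
    ∃ x, ‖pencil A x‖ < t ∧ x + barrierGrad t c A x = g := by
  -- The proximal functional, whose critical points solve the equation. Its sublevel set through `0`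
  -- lies in a compact subset of the open domain, so a minimum is attained there.
  let Φ : EuclideanSpace ℝ (Fin m) → ℝ := fun x => barrier t c A x + 2⁻¹ * ‖x - g‖ ^ 2
  have h0 : ‖pencil A 0‖ < t := by simpa using ht
  have hderiv : ∀ x, ‖pencil A x‖ < t →
      HasFDerivAt Φ (innerSL ℝ (barrierGrad t c A x + (x - g))) x := by
    intro x hx
    have h1 : HasFDerivAt (fun x : EuclideanSpace ℝ (Fin m) => x - g)
      (ContinuousLinearMap.id ℝ _) x := (hasFDerivAt_id x).sub_const g
    refine ((hasFDerivAt_barrier hA hx).add ((h1.norm_sq).const_mul 2⁻¹)).congr_fderiv ?_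
    ext1 v
    simp
  -- Gives `c * b = Φ 0 + c`, hence `barrier ≤ c * b` on the sublevel set; the `+ 1` keeps `b`
  -- positive.
  let b : ℝ := Φ 0 / c + 1
  have hΦ0 : 0 ≤ Φ 0 := add_nonneg (barrier_nonneg hA hc.le h0) (by positivity)
  have hb : 0 < b := by positivity
  have hs : max (t - b⁻¹) 0 < t := max_lt (sub_lt_self _ (inv_pos.2 hb)) ht
  let K : Set (EuclideanSpace ℝ (Fin m)) :=
    Metric.closedBall g (2 * Φ 0 + 1) ∩ {x | ‖pencil A x‖ ≤ max (t - b⁻¹) 0}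
  have hK : IsCompact K := (isCompact_closedBall _ _).inter_right
    (isClosed_le (pencil A).continuous.norm continuous_const)
  have hKD : ∀ x ∈ K, ‖pencil A x‖ < t := fun x hx => hx.2.trans_lt hs
  have hsub : ∀ x, ‖pencil A x‖ < t → Φ x ≤ Φ 0 → x ∈ K := by
    intro x hx hle
    have hbx := barrier_nonneg hA hc.le hx
    have hle' : barrier t c A x + 2⁻¹ * ‖x - g‖ ^ 2 ≤ Φ 0 := hle
    constructor
    · rw [mem_closedBall_iff_norm]
      nlinarith [norm_nonneg (x - g), sq_nonneg (‖x - g‖ - 1)]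
    · refine norm_pencil_le_of_barrier_le hA hc hx hb ?_
      have : c * b = Φ 0 + c := by simp only [b]; field_simp
      nlinarith [sq_nonneg ‖x - g‖]
  obtain ⟨x, hxK, hmin⟩ := hK.exists_isMinOn ⟨0, hsub 0 h0 le_rfl⟩
    (fun x hx => (hderiv x (hKD x hx)).continuousAt.continuousWithinAt)
  have hx := hKD x hxK
  refine ⟨x, hx, ?_⟩
  have hloc : IsLocalMin Φ x := by
    have ho : IsOpen {y | ‖pencil A y‖ < t} :=
      isOpen_lt (pencil A).continuous.norm continuous_const
    filter_upwards [ho.mem_nhds hx] with y hy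
    by_cases hyK : Φ y ≤ Φ 0
    · exact hmin (hsub y hy hyK)
    · exact (hmin (hsub 0 h0 le_rfl)).trans (not_le.1 hyK).le
  have hz := hloc.hasFDerivAt_eq_zero (hderiv x hx)
  have hz' := DFunLike.congr_fun hz (barrierGrad t c A x + (x - g))
  rw [innerSL_apply_apply, _root_.zero_apply, inner_self_eq_zero] at hz'
  have : x + barrierGrad t c A x - g = 0 := by rw [← hz']; abel
  exact sub_eq_zero.1 this

end Barrier

/-! ### The proximal map, its derivative, and the trace bound. -/

section Prox

open Matrix
open scoped Matrix.Norms.L2Operator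

variable {m n : ℕ} {A : Fin m → Matrix (Fin n) (Fin n) ℝ} {t c : ℝ} {x : EuclideanSpace ℝ (Fin m)}

/-- The proximal map of the barrier: a nonexpansive differentiable map into its domain. -/
theorem exists_prox_map (hA : ∀ i, (A i).IsHermitian) (ht : 0 < t) (hc : 0 < c) :
    ∃ x : EuclideanSpace ℝ (Fin m) → EuclideanSpace ℝ (Fin m),
      (∀ g, ‖pencil A (x g)‖ < t) ∧ (∀ g, x g + barrierGrad t c A (x g) = g) ∧
      LipschitzWith 1 x ∧
      ∀ g, ∃ D : EuclideanSpace ℝ (Fin m) →L[ℝ] EuclideanSpace ℝ (Fin m),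
        HasFDerivAt x D g ∧ ∀ v, D v + barrierHess t c A (x g) (D v) = v := by
  choose x hxt hxe using exists_add_barrierGrad_eq (t := t) (c := c) hA ht hc
  have hlip : LipschitzWith 1 x := by
    refine LipschitzWith.of_dist_le_mul fun g g' => ?_
    rw [NNReal.coe_one, one_mul, dist_eq_norm, dist_eq_norm]
    have h1 := inner_barrierGrad_sub_nonneg hA hc.le (hxt g) (hxt g')
    have h2 : g - g' = (x g - x g') + (barrierGrad t c A (x g) - barrierGrad t c A (x g')) := by
      conv_lhs => rw [← hxe g, ← hxe g']
      abel
    have h3 := real_inner_le_norm (x g - x g') (g - g')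
    rw [h2, inner_add_right, real_inner_self_eq_norm_sq, ← h2] at h3
    by_contra! h4
    nlinarith [norm_nonneg (g - g')]
  refine ⟨x, hxt, hxe, hlip, fun g => ?_⟩
  let T : EuclideanSpace ℝ (Fin m) →L[ℝ] EuclideanSpace ℝ (Fin m) :=
    ContinuousLinearMap.id ℝ _ + barrierHess t c A (x g)
  have hT : ∀ v, T v = v + barrierHess t c A (x g) v := fun v => rfl
  have hinj : Function.Injective T := by
    refine (injective_iff_map_eq_zero T).2 fun v hv => ?_
    have h1 := inner_barrierHess_self_nonneg hA hc.le (hxt g) v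
    have h2 : inner ℝ v (T v) = 0 := by rw [hv, inner_zero_right]
    rw [hT, inner_add_right, real_inner_self_eq_norm_sq] at h2
    have : ‖v‖ ^ 2 = 0 := le_antisymm (by linarith) (sq_nonneg _)
    simpa using this
  let e := (LinearEquiv.ofInjectiveEndo (T : EuclideanSpace ℝ (Fin m) →ₗ[ℝ] EuclideanSpace ℝ (Fin m))
    hinj).toContinuousLinearEquiv
  have he : ((e : EuclideanSpace ℝ (Fin m) →L[ℝ] EuclideanSpace ℝ (Fin m))) = T := by
    ext1 v; rfl
  refine ⟨e.symm, ?_, fun v => ?_⟩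
  -- Since `x` is continuous and inverts `y ↦ y + ∇ψ(y)`, whose derivative `1 + H` is invertible, it
  -- is differentiable with derivative `(1 + H)⁻¹`.
  · refine HasFDerivAt.of_local_left_inverse (f := fun y => y + barrierGrad t c A y)
      hlip.continuous.continuousAt ?_ (Filter.Eventually.of_forall hxe)
    rw [he]
    exact (hasFDerivAt_id (x g)).add (hasFDerivAt_barrierGrad hA (hxt g))
  · rw [← hT, ← he]
    exact e.apply_symm_apply v

/-- Bounds on the diagonal of the inverse of `1 + H` for `H` positive semidefinite. -/
theorem diag_inverse_bounds {H D : EuclideanSpace ℝ (Fin m) →L[ℝ] EuclideanSpace ℝ (Fin m)}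
    (hpos : ∀ v, 0 ≤ inner ℝ v (H v)) (hsymm : ∀ v w, inner ℝ w (H v) = inner ℝ v (H w))
    (hD : ∀ v, D v + H (D v) = v) (i : Fin m) :
    0 ≤ D (EuclideanSpace.single i 1) i ∧
      1 - D (EuclideanSpace.single i 1) i ≤ H (EuclideanSpace.single i 1) i := by
  set e : EuclideanSpace ℝ (Fin m) := EuclideanSpace.single i 1
  have hcoord : ∀ v : EuclideanSpace ℝ (Fin m), inner ℝ v e = v i := fun v => by
    simp [e, EuclideanSpace.inner_single_right]
  have hv := hD e
  set v := D e
  have hvi : v i = ‖v‖ ^ 2 + inner ℝ v (H v) := by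
    rw [← hcoord v, ← real_inner_self_eq_norm_sq v, ← inner_add_right, hv]
  refine ⟨hvi ▸ add_nonneg (sq_nonneg _) (hpos v), ?_⟩
  -- Expanding with `v = (1 + H)⁻¹e` gives `Hᵢᵢ ≥ 2(1 - vᵢ) - vᵢ + ‖v‖²`, and `‖v‖² ≥ vᵢ²` makes
  -- this at least `(1 - vᵢ) + (1 - vᵢ)²`.
  have h1 := hpos (v - e)
  have h2 : inner ℝ e (H v) = 1 - v i := by
    have : inner ℝ e (v + H v) = 1 := by
      rw [hv, real_inner_self_eq_norm_sq]; simp [e]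
    rw [inner_add_right, real_inner_comm, hcoord] at this
    linarith
  have h3 : inner ℝ e (H e) = H e i := by rw [real_inner_comm, hcoord]
  have h4 := hsymm v e
  rw [map_sub, inner_sub_left, inner_sub_right, inner_sub_right, h2, h3, ← h4, h2] at h1
  have h5 : v i ^ 2 ≤ ‖v‖ ^ 2 := by
    rw [← sq_abs, ← Real.norm_eq_abs]
    exact pow_le_pow_left₀ (norm_nonneg _) (PiLp.norm_apply_le v i) 2
  nlinarith [sq_nonneg (v i - 1)]

theorem pencilResolvent_mul_pencil_mul (hA : ∀ i, (A i).IsHermitian) (hx : ‖pencil A x‖ < t) :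
    pencilResolvent t A x * pencil A x * pencilResolvent t A x =
      t • (pencilResolvent t A x * pencilResolvent t A x) - pencilResolvent t A x := by
  have hd := (isUnit_iff_isUnit_det _).1 (sub_pencil_posDef hA hx).isUnit
  have h : pencil A x = t • (1 : Matrix (Fin n) (Fin n) ℝ) - (t • 1 - pencil A x) := by abel
  have h2 : pencilResolvent t A x * (t • (1 : Matrix (Fin n) (Fin n) ℝ) - pencil A x) = 1 :=
    nonsing_inv_mul _ hd
  conv_lhs => rw [h, mul_sub, h2]
  simp [sub_mul]

theorem inner_resolventGrad_self (hA : ∀ i, (A i).IsHermitian) (hx : ‖pencil A x‖ < t) :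
    inner ℝ x (resolventGrad t A x) =
      t * (pencilResolvent t A x * pencilResolvent t A x).trace -
        (pencilResolvent t A x).trace := by
  rw [inner_resolventGrad, pencilResolvent_mul_pencil_mul hA hx]
  simp [trace_sub, trace_smul]

theorem sum_trace_mul_le (hsum : ∑ i, A i ≤ 1) {R : Matrix (Fin n) (Fin n) ℝ}
    (hR : R.PosSemidef) : ∑ i, (R * A i).trace ≤ R.trace := by
  rw [← trace_sum, ← Finset.mul_sum]
  exact hR.trace_mul_le_trace hsum

theorem sum_trace_mul_mul_le (hsum : ∑ i, A i ≤ 1) {R : Matrix (Fin n) (Fin n) ℝ}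
    (hR : R.PosSemidef) : ∑ i, (R * A i * R).trace ≤ (R * R).trace := by
  have h := (posSemidef_conjTranspose_mul_self R).trace_mul_le_trace hsum
  rw [hR.1.eq, Finset.mul_sum, trace_sum] at h
  refine le_of_eq_of_le (Finset.sum_congr rfl fun i _ => ?_) h
  rw [trace_mul_comm, mul_assoc]

/-- The effective dimension of the Hessian of the barrier is controlled by its radial derivative. -/
theorem sum_le_inner_barrierGrad (hA : ∀ i, (A i).PosSemidef) (hsum : ∑ i, A i ≤ 1) (ht : 0 < t)
    (hx : ‖pencil A x‖ < t) {d : Fin m → ℝ} (hd1 : ∀ i, d i ≤ 1)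
    (hd : ∀ i, d i ≤ barrierHess t (4 / t) A x (EuclideanSpace.single i 1) i) :
    ∑ i, d i ≤ inner ℝ x (barrierGrad t (4 / t) A x) + 16 * n / t ^ 2 := by
  have hH := fun i => (hA i).1
  have hH' := isHermitian_neg_family hH
  have hx' : ‖pencil (fun i => -A i) x‖ < t := norm_pencil_neg.trans_lt hx
  have hR := (pencilResolvent_posDef hH hx).posSemidef
  have hS := (pencilResolvent_posDef hH' hx').posSemidef
  have hgrad : inner ℝ x (barrierGrad t (4 / t) A x) = 4 / t *
      (inner ℝ x (resolventGrad t A x) + inner ℝ x (resolventGrad t (fun i => -A i) x)) := by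
    rw [barrierGrad, inner_smul_right, inner_add_right]
  rw [inner_resolventGrad_self hH hx, inner_resolventGrad_self hH' hx'] at hgrad
  have hhess : ∀ i, barrierHess t (4 / t) A x (EuclideanSpace.single i 1) i = 4 / t *
      (resolventHess t A x (EuclideanSpace.single i 1) i +
        resolventHess t (fun i => -A i) x (EuclideanSpace.single i 1) i) := fun i => rfl
  simp only [resolventHess_apply, pencil_single] at hhess
  set R := pencilResolvent t A x
  set S := pencilResolvent t (fun i => -A i) x
  have hi : ∀ i, d i ≤ 4 / t * ((R * A i).trace + (S * A i).trace) +
      2 * ((R * A i * R).trace + (S * A i * S).trace) := by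
    intro i
    have a1 := hR.trace_mul_nonneg (hA i)
    have a2 := hS.trace_mul_nonneg (hA i)
    have b1 : 0 ≤ (R * A i * R).trace := by
      have := ((hA i).mul_mul_conjTranspose_same R).trace_nonneg
      rwa [hR.1.eq] at this
    have b2 : 0 ≤ (S * A i * S).trace := by
      have := ((hA i).mul_mul_conjTranspose_same S).trace_nonneg
      rwa [hS.1.eq] at this
    have c1 := hR.trace_sandwich_le (hA i)
    have c2 := hS.trace_sandwich_le (hA i)
    have hdi := hd i
    rw [hhess i] at hdi
    simp only [mul_neg, neg_mul, neg_neg] at hdi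
    set a := (R * A i).trace
    set b := (S * A i).trace
    set p := (R * A i * R).trace
    set q := (S * A i * S).trace
    have h4 : 0 < 4 / t := by positivity
    -- `Hᵢᵢ ≤ (8/t)(ap + bq)`. If `(4/t)(a + b) ≤ 1` this is at most `2(p + q)`; otherwise `d i ≤ 1`
    -- is already below `(4/t)(a + b)`.
    rcases le_total (4 / t * (a + b)) 1 with h | h
    · have e1 : 4 / t * a * p ≤ p := mul_le_of_le_one_left b1 (by nlinarith)
      have e2 : 4 / t * b * q ≤ q := mul_le_of_le_one_left b2 (by nlinarith)
      have e3 := mul_le_mul_of_nonneg_left c1 h4.le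
      have e4 := mul_le_mul_of_nonneg_left c2 h4.le
      have e5 : 0 ≤ 4 / t * (a + b) := by positivity
      linarith
    · linarith [hd1 i]
  have hsum1 : ∑ i, d i ≤ 4 / t * (R.trace + S.trace) + 2 * ((R * R).trace + (S * S).trace) := by
    refine (Finset.sum_le_sum fun i _ => hi i).trans ?_
    rw [Finset.sum_add_distrib, ← Finset.mul_sum, ← Finset.mul_sum, Finset.sum_add_distrib,
      Finset.sum_add_distrib]
    have := sum_trace_mul_le hsum hR
    have := sum_trace_mul_le hsum hS
    have := sum_trace_mul_mul_le hsum hR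
    have := sum_trace_mul_mul_le hsum hS
    gcongr
  -- The radial derivative supplies `4 tr R² - (4/t) tr R`, leaving `(8/t) tr R - 2 tr R²` to bound;
  -- the parameter `2/t` cancels the linear term exactly and leaves `8n/t²`, likewise for `S`.
  have k1 := hR.1.trace_mul_self_ge (2 / t)
  have k2 := hS.1.trace_mul_self_ge (2 / t)
  rw [Fintype.card_fin] at k1 k2
  have e1 : 4 / t * (t * (R * R).trace - R.trace + (t * (S * S).trace - S.trace)) =
      4 * ((R * R).trace + (S * S).trace) - 4 / t * (R.trace + S.trace) := by
    field_simp; ring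
  have e2 : 16 * (n : ℝ) / t ^ 2 = 4 * ((2 / t) ^ 2 * n) := by field_simp; ring
  have e3 : 4 / t = 2 * (2 / t) := by ring
  rw [hgrad, e1, e2]
  rw [e3] at hsum1 ⊢
  linarith

end Prox

/-! ### Mean square displacement of a Gaussian vector. -/

open MeasureTheory ProbabilityTheory

section Expectation

variable {m n : ℕ}

theorem memLp_two_coord_stdGaussian (i : Fin m) :
    MemLp (fun g : EuclideanSpace ℝ (Fin m) => g i) 2 (stdGaussian (EuclideanSpace ℝ (Fin m))) := by
  have h : MemLp (id : EuclideanSpace ℝ (Fin m) → _) 2 (stdGaussian (EuclideanSpace ℝ (Fin m))) :=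
    IsGaussian.memLp_two_id
  exact h.continuousLinearMap_comp (EuclideanSpace.proj (𝕜 := ℝ) i)

theorem integral_coord_sq_stdGaussian (i : Fin m) :
    ∫ g, g i ^ 2 ∂(stdGaussian (EuclideanSpace ℝ (Fin m))) = 1 := by
  have hd : ∀ x, HasFDerivAt (fun g : EuclideanSpace ℝ (Fin m) => g i)
      (EuclideanSpace.proj (𝕜 := ℝ) i : EuclideanSpace ℝ (Fin m) →L[ℝ] ℝ) x :=
    fun x => (EuclideanSpace.proj (𝕜 := ℝ) i : EuclideanSpace ℝ (Fin m) →L[ℝ] ℝ).hasFDerivAt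
  have hM := memLp_two_coord_stdGaussian i
  have h := integral_coord_mul_stdGaussian i (f := fun g => g i) (C := 1)
    (fun x => (hd x).differentiableAt) (fun x => by rw [(hd x).fderiv]; simp)
    (by simpa [sq] using hM.integrable_sq) (hM.integrable one_le_two)
  simp only [(hd _).fderiv] at h
  simpa [sq] using h

/-- Energy estimate for the displacement of a differentiable nonexpansive map. -/
theorem integral_norm_sub_sq_le {x : EuclideanSpace ℝ (Fin m) → EuclideanSpace ℝ (Fin m)}
    (hx : LipschitzWith 1 x)
    {D : EuclideanSpace ℝ (Fin m) → EuclideanSpace ℝ (Fin m) →L[ℝ] EuclideanSpace ℝ (Fin m)}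
    (hD : ∀ g, HasFDerivAt x (D g) g) {C : ℝ}
    (hdiv : ∀ g, ∑ i, (1 - D g (EuclideanSpace.single i 1) i) ≤ inner ℝ (x g) (g - x g) + C) :
    Integrable (fun g => ‖g - x g‖ ^ 2) (stdGaussian (EuclideanSpace ℝ (Fin m))) ∧
      ∫ g, ‖g - x g‖ ^ 2 ∂(stdGaussian (EuclideanSpace ℝ (Fin m))) ≤ C := by
  set μ := stdGaussian (EuclideanSpace ℝ (Fin m))
  have hid : MemLp (id : EuclideanSpace ℝ (Fin m) → _) 2 μ := IsGaussian.memLp_two_id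
  have hxL : MemLp x 2 μ := by
    have h1 : MemLp (fun g => x g - x 0) 2 μ := by
      refine hid.mono (hx.continuous.sub continuous_const).aestronglyMeasurable
        (Filter.Eventually.of_forall fun g => ?_)
      simpa [dist_eq_norm] using hx.dist_le_mul g 0
    have h2 := h1.add (memLp_const (μ := μ) (p := 2) (x 0))
    refine h2.ae_eq (Filter.Eventually.of_forall fun g => ?_)
    simp
  have hu : MemLp (fun g => g - x g) 2 μ := hid.sub hxL
  have hui : ∀ i, MemLp (fun g => (g - x g) i) 2 μ := fun i =>
    hu.continuousLinearMap_comp (EuclideanSpace.proj (𝕜 := ℝ) i)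
  have hder : ∀ i g, HasFDerivAt (fun g => (g - x g) i)
      ((EuclideanSpace.proj (𝕜 := ℝ) i : EuclideanSpace ℝ (Fin m) →L[ℝ] ℝ).comp
        (ContinuousLinearMap.id ℝ _ - D g)) g := fun i g =>
    (EuclideanSpace.proj (𝕜 := ℝ) i : EuclideanSpace ℝ (Fin m) →L[ℝ] ℝ).hasFDerivAt.comp g
      ((hasFDerivAt_id g).sub (hD g))
  have hfd : ∀ i g, fderiv ℝ (fun g => (g - x g) i) g (EuclideanSpace.single i 1) =
      1 - D g (EuclideanSpace.single i 1) i := by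
    intro i g
    rw [(hder i g).fderiv]
    simp
  -- Nonexpansiveness gives `‖D g‖ ≤ 1`; this uniform bound is what integration by parts requires.
  have hbd : ∀ i g, |1 - D g (EuclideanSpace.single i 1) i| ≤ 2 := by
    intro i g
    have h1 : ‖D g‖ ≤ 1 := by
      rw [← (hD g).fderiv]; simpa using norm_fderiv_le_of_lipschitz ℝ hx (x₀ := g)
    have h2 := (PiLp.norm_apply_le (D g (EuclideanSpace.single i 1)) i).trans
      ((D g).le_of_opNorm_le h1 (EuclideanSpace.single i 1))
    rw [Real.norm_eq_abs, abs_le] at h2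
    simp only [PiLp.norm_single, norm_one, mul_one] at h2
    rw [abs_le]
    constructor <;> linarith [h2.1, h2.2]
  have hgi : ∀ i, Integrable (fun g => g i * (g - x g) i) μ := fun i =>
    (memLp_two_coord_stdGaussian i).integrable_mul (hui i)
  have hst : ∀ i, ∫ g, g i * (g - x g) i ∂μ = ∫ g, (1 - D g (EuclideanSpace.single i 1) i) ∂μ := by
    intro i
    have := integral_coord_mul_stdGaussian i (f := fun g => (g - x g) i) (C := 2)
      (fun g => (hder i g).differentiableAt) (fun g => by rw [hfd]; exact hbd i g)
      (hgi i) ((hui i).integrable one_le_two)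
    simpa only [hfd] using this
  have hdi : ∀ i, Integrable (fun g => 1 - D g (EuclideanSpace.single i 1) i) μ := by
    intro i
    simp only [← hfd]
    exact Integrable.of_bound (measurable_fderiv_apply_const ℝ _ _).aestronglyMeasurable 2
      (Filter.Eventually.of_forall fun g => by rw [hfd]; exact hbd i g)
  have hint : Integrable (fun g => ‖g - x g‖ ^ 2) μ := hu.integrable_norm_pow two_ne_zero
  refine ⟨hint, ?_⟩
  have hinner : ∀ g, ∑ i, g i * (g - x g) i = inner ℝ (x g) (g - x g) + ‖g - x g‖ ^ 2 := by
    intro g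
    rw [← real_inner_self_eq_norm_sq, ← inner_add_left, add_sub_cancel]
    simp [PiLp.inner_apply, mul_comm]
  have hsum : ∫ g, ∑ i, g i * (g - x g) i ∂μ =
      ∫ g, ∑ i, (1 - D g (EuclideanSpace.single i 1) i) ∂μ := by
    rw [integral_finsetSum _ fun i _ => hgi i, integral_finsetSum _ fun i _ => hdi i]
    exact Finset.sum_congr rfl fun i _ => hst i
  have hI1 : Integrable (fun g => ∑ i, g i * (g - x g) i) μ := integrable_finsetSum _ fun i _ => hgi i
  have hI2 : Integrable (fun g => ∑ i, (1 - D g (EuclideanSpace.single i 1) i)) μ :=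
    integrable_finsetSum _ fun i _ => hdi i
  have hpt : ∀ g, ‖g - x g‖ ^ 2 ≤ ∑ i, g i * (g - x g) i -
      ∑ i, (1 - D g (EuclideanSpace.single i 1) i) + C := by
    intro g
    rw [hinner]
    linarith [hdiv g]
  have hI3 : Integrable (fun g => ∑ i, g i * (g - x g) i -
      ∑ i, (1 - D g (EuclideanSpace.single i 1) i)) μ := hI1.sub hI2
  calc ∫ g, ‖g - x g‖ ^ 2 ∂μ ≤ ∫ g, (∑ i, g i * (g - x g) i -
        ∑ i, (1 - D g (EuclideanSpace.single i 1) i) + C) ∂μ :=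
        integral_mono hint (hI3.add (integrable_const C)) hpt
    _ = C := by
        rw [integral_add hI3 (integrable_const C), integral_sub hI1 hI2, hsum]
        simp

/-- A Gaussian vector is close, in mean square, to the set `{x | ‖∑ i, x i • A i‖ < t}`. -/
theorem exists_map_integral_norm_sub_sq_le {A : Fin m → Matrix (Fin n) (Fin n) ℝ}
    (hA : ∀ i, (A i).PosSemidef) (hsum : ∑ i, A i ≤ 1) {t : ℝ} (ht : 0 < t) :
    ∃ x : EuclideanSpace ℝ (Fin m) → EuclideanSpace ℝ (Fin m),
      (∀ g, ‖Matrix.toEuclideanCLM (n := Fin n) (𝕜 := ℝ) (∑ i, x g i • A i)‖ ≤ t) ∧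
      (∀ g i, A i = 0 → x g i = g i) ∧
      Integrable (fun g => ‖g - x g‖ ^ 2) (stdGaussian (EuclideanSpace ℝ (Fin m))) ∧
      ∫ g, ‖g - x g‖ ^ 2 ∂(stdGaussian (EuclideanSpace ℝ (Fin m))) ≤ 16 * n / t ^ 2 := by
  have hc : 0 < 4 / t := by positivity
  have hH := fun i => (hA i).1
  obtain ⟨x, hxt, hxe, hlip, hx⟩ := exists_prox_map hH ht hc
  choose D hD hDe using hx
  refine ⟨x, fun g => ?_, fun g i hi => ?_, integral_norm_sub_sq_le hlip hD fun g => ?_⟩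
  · exact (Matrix.l2_opNorm_toEuclideanCLM (pencil A (x g))).trans_le (hxt g).le
  · conv_rhs => rw [← hxe g]
    simp [barrierGrad, resolventGrad, hi]
  · have h := fun i => diag_inverse_bounds (inner_barrierHess_self_nonneg hH hc.le (hxt g))
      (inner_barrierHess_symm hH (hxt g)) (hDe g) i
    have hg : g - x g = barrierGrad t (4 / t) A (x g) := by
      rw [sub_eq_iff_eq_add']; exact (hxe g).symm
    rw [hg]
    exact sum_le_inner_barrierGrad hA hsum ht (hxt g) (fun i => by linarith [(h i).1])
      (fun i => (h i).2)

end Expectation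

/-! ### Passing to the section `K(J)` and Markov's inequality. -/

theorem lemma13 (n m : ℕ) (A : Fin m → Matrix (Fin n) (Fin n) ℝ)
    (hA : ∀ i, (A i).PosSemidef) (hsum : ∑ i, A i ≤ 1)
    (α β ε : ℝ) (hα : α ∈ Set.Ioo (0 : ℝ) 1) (hβ : β ∈ Set.Ioo (0 : ℝ) 1)
    (hε : ε ∈ Set.Ioo (0 : ℝ) 1) (hm : (m : ℝ) = n / ε ^ 2)
    (hα5 : α ^ 2 ≤ 1 / 5) (hαβ : 5 * β ≤ α ^ 2)
    (J : Finset (Fin m)) (hJ : (J.card : ℝ) ≤ β * m) :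
    1 / 2 ≤ ProbabilityTheory.stdGaussian (EuclideanSpace ℝ (Fin m))
      ((50 / α) • coordinateSection (spectralBody A ε) J
        + (α * √(m : ℝ)) • Metric.closedBall (0 : EuclideanSpace ℝ (Fin m)) 1) := by
  obtain ⟨hα0, -⟩ := hα
  obtain ⟨hε0, -⟩ := hε
  set μ := stdGaussian (EuclideanSpace ℝ (Fin m))
  have ht : 0 < 50 / α * ε := by positivity
  let A' : Fin m → Matrix (Fin n) (Fin n) ℝ := fun i => if i ∈ J then 0 else A i
  have hA' : ∀ i, (A' i).PosSemidef := fun i => by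
    simp only [A']; split_ifs
    exacts [Matrix.PosSemidef.zero, hA i]
  have hsum' : ∑ i, A' i ≤ 1 := by
    refine (Finset.sum_le_sum fun i _ => ?_).trans hsum
    simp only [A']; split_ifs
    exacts [Matrix.nonneg_iff_posSemidef.2 (hA i), le_rfl]
  obtain ⟨x, hxt, hxJ, hint, hle⟩ := exists_map_integral_norm_sub_sq_le hA' hsum' ht
  -- Deleting the coordinates in `J` leaves the pencil of `A'` unchanged, and there it agrees with
  -- the pencil of `A`.
  let z : EuclideanSpace ℝ (Fin m) → EuclideanSpace ℝ (Fin m) :=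
    fun g => WithLp.toLp 2 fun i => if i ∈ J then 0 else x g i
  have hzmem : ∀ g, z g ∈ (50 / α) • coordinateSection (spectralBody A ε) J := by
    intro g
    refine ⟨(50 / α)⁻¹ • z g, ⟨?_, fun j hj => by simp [z, hj]⟩, smul_inv_smul₀ (by positivity) _⟩
    have h1 : ∑ i, ((50 / α)⁻¹ • z g) i • A i = (50 / α)⁻¹ • ∑ i, x g i • A' i := by
      rw [Finset.smul_sum]
      refine Finset.sum_congr rfl fun i _ => ?_
      by_cases hi : i ∈ J <;> simp [z, A', hi, smul_smul]
    rw [spectralBody, Set.mem_ofPred_eq, h1, map_smul, norm_smul, Real.norm_eq_abs,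
      abs_of_pos (by positivity), inv_mul_le_iff₀ (by positivity)]
    exact hxt g
  have hdist : ∀ g, ‖g - z g‖ ^ 2 ≤ ‖g - x g‖ ^ 2 + ∑ i ∈ J, g i ^ 2 := by
    intro g
    rw [EuclideanSpace.real_norm_sq_eq, EuclideanSpace.real_norm_sq_eq,
      ← Finset.univ_inter J, ← Finset.sum_ite_mem, ← Finset.sum_add_distrib]
    refine Finset.sum_le_sum fun i _ => ?_
    by_cases hi : i ∈ J
    · simp [z, hi, sq_nonneg]
    · simp [z, hi]
  have hmem : ∀ g, ‖g - z g‖ ≤ α * √(m : ℝ) → g ∈ (50 / α) • coordinateSection (spectralBody A ε) J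
      + (α * √(m : ℝ)) • Metric.closedBall (0 : EuclideanSpace ℝ (Fin m)) 1 := by
    intro g hg
    refine Set.mem_add.2 ⟨z g, hzmem g, g - z g, ?_, add_sub_cancel _ _⟩
    rw [smul_closedBall _ _ zero_le_one, smul_zero, mul_one, mem_closedBall_zero_iff,
      Real.norm_of_nonneg (by positivity)]
    exact hg
  -- Markov's inequality needs the threshold `α²m` to be positive.
  obtain rfl | hm0 := Nat.eq_zero_or_pos m
  · have : ((50 / α) • coordinateSection (spectralBody A ε) J
        + (α * √((0 : ℕ) : ℝ)) • Metric.closedBall (0 : EuclideanSpace ℝ (Fin 0)) 1) = Set.univ :=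
      Set.eq_univ_of_forall fun g => hmem g (by
        rw [Subsingleton.elim (g - z g) 0, norm_zero]; positivity)
    rw [this, measure_univ]
    exact ENNReal.half_le_self
  have hmR : (0 : ℝ) < m := Nat.cast_pos.2 hm0
  let f : EuclideanSpace ℝ (Fin m) → ℝ := fun g => ‖g - x g‖ ^ 2 + ∑ i ∈ J, g i ^ 2
  have hJint : ∀ i ∈ J, Integrable (fun g : EuclideanSpace ℝ (Fin m) => g i ^ 2) μ := fun i _ =>
    (memLp_two_coord_stdGaussian i).integrable_sq
  have hfint : Integrable f μ := hint.add (integrable_finsetSum _ hJint)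
  have hfle : ∫ g, f g ∂μ ≤ α ^ 2 * m / 2 := by
    have e1 : ∫ g, f g ∂μ = ∫ g, ‖g - x g‖ ^ 2 ∂μ + J.card := by
      rw [integral_add hint (integrable_finsetSum _ hJint), integral_finsetSum _ hJint]
      simp [μ, integral_coord_sq_stdGaussian]
    -- The two contributions are `16/2500` and at most `1/5` of `α²m`, together below one half.
    have e2 : 16 * (n : ℝ) / (50 / α * ε) ^ 2 = 16 / 2500 * (α ^ 2 * m) := by
      rw [hm]; field_simp; norm_num
    have e3 : β * m ≤ α ^ 2 / 5 * m := mul_le_mul_of_nonneg_right (by linarith) hmR.le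
    rw [e1]
    nlinarith [mul_pos (pow_pos hα0 2) hmR]
  have ha : 0 < α ^ 2 * m := mul_pos (pow_pos hα0 2) hmR
  have hmarkov : μ.real {g | α ^ 2 * m ≤ f g} ≤ 1 / 2 := by
    have h := mul_meas_ge_le_integral_of_nonneg (μ := μ) (f := f)
      (Filter.Eventually.of_forall fun g => add_nonneg (sq_nonneg _)
        (Finset.sum_nonneg fun i _ => sq_nonneg _)) hfint (α ^ 2 * m)
    have h' := h.trans hfle
    by_contra! hcon
    nlinarith
  have hnull : NullMeasurableSet {g | α ^ 2 * m ≤ f g} μ :=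
    nullMeasurableSet_le aemeasurable_const hfint.aemeasurable
  have hcompl : 1 / 2 ≤ μ.real {g | α ^ 2 * m ≤ f g}ᶜ := by
    rw [measureReal_compl₀ hnull, probReal_univ]
    linarith
  calc (1 / 2 : ENNReal) = ENNReal.ofReal (1 / 2) := by
        rw [ENNReal.ofReal_div_of_pos two_pos]; simp
    _ ≤ μ {g | α ^ 2 * m ≤ f g}ᶜ := by
        rw [← ofReal_measureReal]
        exact ENNReal.ofReal_le_ofReal hcompl
    _ ≤ _ := measure_mono fun g hg => hmem g ?_
  have hg' : f g < α ^ 2 * m := not_le.1 hg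
  refine abs_le_of_sq_le_sq' ?_ (by positivity) |>.2
  rw [mul_pow, Real.sq_sqrt hmR.le]
  exact (hdist g).trans hg'.le
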